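/- Let $A\in\mathbb{R}^{n\times n}$, $b,c\in\mathbb{R}^n$ and $\mathbf{G}=[g_{ij}]\in\mathbb{R}^{N\times N}$ be such that $I_N\otimes A+\mathbf{G}\otimes bc^{T}$ is Hurwitz, and consider the network of $N$ identical nodes $$\dot{\mathbf{x}}(t)=(I_N\otimes A+\mathbf{G}\otimes bc^{T})\,\mathbf{x}(t)+(I_N\otimes b)\,\mathbf{w}(t),\qquad \mathbf{y}(t)=(I_N\otimes c^{T})\,\mathbf{x}(t),\qquad t\in\mathbb{R},$$ in steady state, i.e. $\mathbf{x}$ is a solution on all of $\mathbb{R}$ whose second moments are bounded uniformly in time. For wide-sense stationary (WSS) processes write $R_{uv}(\tau)=\mathbb{E}(u(t)v(t-\tau))$ and let $S_{uv}(\omega)=\int_{\mathbb{R}}R_{uv}(\tau)e^{-\mathbf{j}\omega\tau}\,d\tau$ be the (cross-)power spectral density. Assume: (A1) the inputs $w_1(t),\dots,w_N(t)$ are mutually uncorrelated, zero-mean, real WSS processes with a common autocorrelation function $R_w(\tau)=\mathbb{E}(w_i(t)w_i(t+\tau))$, which is integrable, so that the common power spectral density $S_w(\omega)=\int_{\mathbb{R}}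 R_w(\tau)e^{-\mathbf{j}\omega\tau}\,d\tau$ is defined; (A2) there is $\Omega>0$ such that $S_{w}(\omega)>0$ for all $\omega\in(-\Omega,\Omega)$. Then the outputs $y_1,\dots,y_N$ are jointly WSS with integrable cross-correlation functions. Let $h(\mathbf{j}\omega)=c^{T}(\mathbf{j}\omega I_n-A)^{-1}b$ be the nodal transfer function and let $h^{*}$ denote its complex conjugate. For every $\omega\in\mathbb{R}$ such that $\mathbf{j}\omega I_n-A$ is nonsingular and $h(\mathbf{j}\omega)\neq0$, the matrix in parentheses below is nonsingular, and the matrix $\mathbf{S}(\omega)=[S_{y_iy_j}(\omega)]$ of output cross-power spectral densities is $$\mathbf{S}(\omega)=S_w(\omega)\left(\frac{I_N}{|h(\mathbf{j}\omega)|^{2}}+\mathbf{G}^{T}\mathbf{G}-\frac{\mathbf{G}}{h^{*}(\mathbf{j}\omega)}-\frac{\mathbf{G}^{T}}{h(\mathbf{j}\omega)}\right)^{-1}.$$ -/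

import Mathlib

open MeasureTheory Matrix
open scoped Kronecker ComplexConjugate

noncomputable section

/-! ### Second-order statistics of real stochastic processes -/

section Statistics

variable {S : Type*} [MeasurableSpace S]

/-- Cross-correlation function `R_{XY}(τ) = E (X(t) Y(t - τ))` of two real processes, evaluated at
the reference time `t = 0`.  For jointly wide-sense stationary processes the choice of the
reference time is immaterial; see `IsJointlyWSS.corr`. -/
def crossCorrelation (μ : Measure S) (X Y : ℝ → S → ℝ) (τ : ℝ) : ℝ :=
  ∫ o, X 0 o * Y (0 - τ) o ∂μ

/-- The Fourier transform `ω ↦ ∫ R(τ) e^{-jωτ} dτ` of a correlation function. -/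
def spectralDensity (R : ℝ → ℝ) (ω : ℝ) : ℂ :=
  ∫ τ : ℝ, (R τ : ℂ) * Complex.exp (-(Complex.I * ω * τ))

/-- Cross-power spectral density `S_{XY}(ω)`, the Fourier transform of `R_{XY}`. -/
def crossPowerSpectralDensity (μ : Measure S) (X Y : ℝ → S → ℝ) (ω : ℝ) : ℂ :=
  spectralDensity (crossCorrelation μ X Y) ω

/-- The `i`-th component of a vector-valued process. -/
def component {ι : Type*} (v : ℝ → S → ι → ℝ) (i : ι) : ℝ → S → ℝ :=
  fun t o => v t o i

/-- The components of the vector process `v` are jointly wide-sense stationary: they have finite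
second moments, constant means, and `E (v_i(t) v_j(t - τ))` does not depend on `t`. -/
structure IsJointlyWSS {ι : Type*} (μ : Measure S) (v : ℝ → S → ι → ℝ) : Prop where
  memLp : ∀ i t, MemLp (component v i t) 2 μ
  mean : ∀ i s t, ∫ o, component v i s o ∂μ = ∫ o, component v i t o ∂μ
  corr : ∀ i j t τ, ∫ o, component v i t o * component v j (t - τ) o ∂μ =
    crossCorrelation μ (component v i) (component v j) τ

/-- The matrix `[S_{v_i v_j}(ω)]` of cross-power spectral densities of a vector process. -/
def cpsdMatrix {ι : Type*} (μ : Measure S) (v : ℝ → S → ι → ℝ) (ω : ℝ) : Matrix ι ι ℂ :=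
  Matrix.of fun i j => crossPowerSpectralDensity μ (component v i) (component v j) ω

/-- The input assumption: the `w_i` are (jointly measurable, finite-variance) zero-mean,
mutually uncorrelated wide-sense stationary processes with the same autocorrelation function
`R(τ) = E (w_i(t) w_i(t + τ))`. -/
structure IsUncorrelatedWSSInput {ι : Type*} (μ : Measure S) (w : ℝ → S → ι → ℝ)
    (R : ℝ → ℝ) : Prop where
  measurable : ∀ i, Measurable fun p : ℝ × S => component w i p.1 p.2
  memLp : ∀ i t, MemLp (component w i t) 2 μ
  mean_zero : ∀ i t, ∫ o, component w i t o ∂μ = 0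
  autocorr : ∀ i t τ, ∫ o, component w i t o * component w i (t + τ) o ∂μ = R τ
  uncorr : ∀ i j, i ≠ j → ∀ s t, ∫ o, component w i s o * component w j t o ∂μ = 0

/-- `(-β, β)` is an excitation frequency interval of `w`: `β > 0` and the power spectral density of
every component is (real and) strictly positive on `(-β, β)`. -/
def IsExcitationInterval {ι : Type*} (μ : Measure S) (w : ℝ → S → ι → ℝ) (β : ℝ) : Prop :=
  0 < β ∧ ∀ i, ∀ ω ∈ Set.Ioo (-β) β, ∃ r : ℝ, 0 < r ∧
    crossPowerSpectralDensity μ (component w i) (component w i) ω = (r : ℂ)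

end Statistics

/-! ### The network of identical linear time-invariant nodes -/

section Network

variable {N n : ℕ}

/-- A real square matrix is Hurwitz if all its complex eigenvalues have negative real part. -/
def IsHurwitz {ι : Type*} [Fintype ι] [DecidableEq ι] (M : Matrix ι ι ℝ) : Prop :=
  ∀ z ∈ spectrum ℂ (M.map (fun r : ℝ => (r : ℂ))), z.re < 0

/-- The network state matrix `I_N ⊗ A + G ⊗ b cᵀ`. -/
def networkStateMatrix (A : Matrix (Fin n) (Fin n) ℝ) (b c : Fin n → ℝ)
    (G : Matrix (Fin N) (Fin N) ℝ) : Matrix (Fin N × Fin n) (Fin N × Fin n) ℝ :=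
  (1 : Matrix (Fin N) (Fin N) ℝ) ⊗ₖ A + G ⊗ₖ vecMulVec b c

/-- The network input matrix `I_N ⊗ b`. -/
def networkInputMatrix (N : ℕ) (b : Fin n → ℝ) : Matrix (Fin N × Fin n) (Fin N) ℝ :=
  ((1 : Matrix (Fin N) (Fin N) ℝ) ⊗ₖ replicateCol Unit b).submatrix id (fun k => (k, ()))

/-- The network output matrix `I_N ⊗ cᵀ`. -/
def networkOutputMatrix (N : ℕ) (c : Fin n → ℝ) : Matrix (Fin N) (Fin N × Fin n) ℝ :=
  ((1 : Matrix (Fin N) (Fin N) ℝ) ⊗ₖ replicateRow Unit c).submatrix (fun k => (k, ())) id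

/-- `ξ` solves `ξ' = M ξ + B u` on the whole time axis, in the Carathéodory sense: the forcing is
locally integrable, `ξ` is continuous, and the integrated equation holds. -/
structure IsSolutionPath {ι κ : Type*} [Fintype ι] [Fintype κ] (M : Matrix ι ι ℝ)
    (B : Matrix ι κ ℝ) (u : ℝ → κ → ℝ) (ξ : ℝ → ι → ℝ) : Prop where
  input_integrable : LocallyIntegrable u volume
  continuous : Continuous ξ
  integral_eq : ∀ s t : ℝ, ξ t - ξ s = ∫ r in s..t, (M *ᵥ ξ r + B *ᵥ u r)

/-- `x` is a steady-state response of `x' = M x + B u`, where `u` is a random input: almost every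
path solves the equation on all of `ℝ`, and the second moments are bounded uniformly in time. -/
structure IsSteadyStateResponse {S : Type*} [MeasurableSpace S] {ι κ : Type*} [Fintype ι]
    [Fintype κ] (μ : Measure S) (M : Matrix ι ι ℝ) (B : Matrix ι κ ℝ) (u : ℝ → S → κ → ℝ)
    (x : ℝ → S → ι → ℝ) : Prop where
  memLp : ∀ p t, MemLp (component x p t) 2 μ
  bounded : ∃ K : ℝ, ∀ p t, ∫ o, component x p t o ^ 2 ∂μ ≤ K
  solution : ∀ᵐ o ∂μ, IsSolutionPath M B (fun t => u t o) (fun t => x t o)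

/-- The output process `y(t) = C x(t)`. -/
def outputProcess {S : Type*} {ι κ : Type*} [Fintype ι] (C : Matrix κ ι ℝ) (x : ℝ → S → ι → ℝ) :
    ℝ → S → κ → ℝ :=
  fun t o => C *ᵥ x t o

/-- The matrix `s I_n - A` over the complex numbers. -/
def characteristicPencil (A : Matrix (Fin n) (Fin n) ℝ) (s : ℂ) : Matrix (Fin n) (Fin n) ℂ :=
  s • (1 : Matrix (Fin n) (Fin n) ℂ) - A.map (fun r : ℝ => (r : ℂ))

/-- The nodal transfer function `h(s) = cᵀ (s I_n - A)⁻¹ b`. -/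
def nodalTransfer (A : Matrix (Fin n) (Fin n) ℝ) (b c : Fin n → ℝ) (s : ℂ) : ℂ :=
  (fun i => (c i : ℂ)) ⬝ᵥ ((characteristicPencil A s)⁻¹ *ᵥ fun i => (b i : ℂ))

/-- The matrix `I_N / |h|² + Gᵀ G - G / h* - Gᵀ / h`, for a complex number `h`. -/
def inverseSpectrumMatrix (G : Matrix (Fin N) (Fin N) ℝ) (h : ℂ) : Matrix (Fin N) (Fin N) ℂ :=
  let Gc : Matrix (Fin N) (Fin N) ℂ := G.map (fun r : ℝ => (r : ℂ))
  (1 / (‖h‖ : ℂ) ^ 2) • (1 : Matrix (Fin N) (Fin N) ℂ) + Gcᵀ * Gc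
    - (1 / conj h) • Gc - (1 / h) • Gcᵀ

end Network

end

/-!
A Hurwitz system forgets its initial condition. By variation of constants, `x(t)` is
`exp (TM) x(t - T)` plus the input of the last `T` time units weighted by `exp (sM) B`; the entries
of `exp (TM)` vanish as `T → ∞` while the second moments of `x` stay bounded, so at each time the
output is almost surely the convolution of the input with the integrable impulse response
`C exp (sM) B` (`IsSteadyStateResponse.isFilterResponse`). No choice of solution is left.

For such a filtered input everything follows from Fubini's theorem: the correlation functions are
double integrals of the impulse responses against `R_w`, which depend on the lag only and are
integrable, and their Fourier transform gives the spectral matrix `S_w H Hᴴ`, where `H` is the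
matrix of frequency responses (`IsFilterResponse.cpsdMatrix_eq`). Inputs at distinct nodes do not
interact, being uncorrelated.

The frequency response is the Laplace transform of the impulse response, that is
`H = C (iω - M)⁻¹ B` (`sub_mul_laplace_exp`). Solving this node by node gives the feedback equation
`H = h (1 + G H)`, hence `(1/h - G) H = 1` (`loop_inverse`). Since the matrix of the spectral
formula factors as `(1/h - G)ᴴ (1/h - G)`, its inverse is `H Hᴴ`.

The decay of the matrix exponential is read off from generalized eigenvectors
(`isDecaying_exp_smul_mulVec`).
-/

section

open Filter Topology Set

/-! ### Decay and Laplace transform of the matrix exponential -/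

section MatrixExponential

open scoped Matrix.Norms.Operator

variable {ι : Type*} [Fintype ι] [DecidableEq ι]

/-- A function on the half-line `t > 0` that is integrable and vanishes at infinity. This is all
that is needed about the exponential decay of a stable impulse response. -/
structure IsDecaying (f : ℝ → ℂ) : Prop where
  integrableOn : IntegrableOn f (Ioi 0)
  tendsto : Tendsto f atTop (𝓝 0)

lemma IsDecaying.zero : IsDecaying fun _ => 0 :=
  ⟨integrableOn_zero, tendsto_const_nhds⟩

lemma IsDecaying.add {f g : ℝ → ℂ} (hf : IsDecaying f) (hg : IsDecaying g) :
    IsDecaying fun t => f t + g t :=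
  ⟨hf.1.add hg.1, by simpa using hf.2.add hg.2⟩

lemma IsDecaying.mul_const {f : ℝ → ℂ} (hf : IsDecaying f) (a : ℂ) :
    IsDecaying fun t => f t * a :=
  ⟨hf.1.mul_const a, by simpa using hf.2.mul_const a⟩

lemma IsDecaying.sum {κ : Type*} (s : Finset κ) {f : κ → ℝ → ℂ}
    (hf : ∀ k ∈ s, IsDecaying (f k)) :
    IsDecaying fun t => ∑ k ∈ s, f k t :=
  ⟨integrable_finsetSum _ fun k hk => (hf k hk).1,
    by simpa using tendsto_finsetSum s fun k hk => (hf k hk).2⟩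

lemma isDecaying_pow_mul_exp (z : ℂ) (hz : z.re < 0) (k : ℕ) :
    IsDecaying fun t : ℝ => (t : ℂ) ^ k * Complex.exp (t * z) := by
  have hnorm : ∀ t : ℝ, 0 < t →
      ‖(t : ℂ) ^ k * Complex.exp (t * z)‖ = t ^ k * Real.exp (-(-z.re) * t) := by
    intro t ht
    rw [norm_mul, norm_pow, Complex.norm_exp, Complex.norm_real, Real.norm_of_nonneg ht.le]
    congr 2
    simp [mul_comm]
  constructor
  · have h := integrableOn_rpow_mul_exp_neg_mul_rpow (p := 1) (s := k) (b := -z.re)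
      (by have : (0 : ℝ) ≤ k := k.cast_nonneg
          linarith) one_pos (by linarith)
    refine (integrable_norm_iff (Continuous.aestronglyMeasurable (by fun_prop))).1 ?_
    refine h.congr_fun (fun t ht => ?_) measurableSet_Ioi
    simp only [hnorm t ht, Real.rpow_natCast, Real.rpow_one]
  · refine tendsto_zero_iff_norm_tendsto_zero.2 ?_
    have h := tendsto_rpow_mul_exp_neg_mul_atTop_nhds_zero (k : ℝ) (-z.re) (by linarith)
    refine h.congr' ?_
    filter_upwards [eventually_gt_atTop 0] with t ht
    rw [hnorm t ht, Real.rpow_natCast]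

/-- On a generalized eigenvector the matrix exponential is an exponential polynomial. -/
lemma exp_smul_mulVec_of_pow_mulVec_eq_zero (M : Matrix ι ι ℂ) (z : ℂ) (m : ℕ) (v : ι → ℂ)
    (hv : (M - z • (1 : Matrix ι ι ℂ)) ^ m *ᵥ v = 0) (t : ℝ) :
    NormedSpace.exp ((t : ℂ) • M) *ᵥ v = ∑ k ∈ Finset.range m,
      ((t : ℂ) ^ k * Complex.exp (t * z)) •
        ((k.factorial : ℂ)⁻¹ • ((M - z • (1 : Matrix ι ι ℂ)) ^ k *ᵥ v)) := by
  set Q := M - z • (1 : Matrix ι ι ℂ) with hQ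
  have hsplit : (t : ℂ) • M = ((t : ℂ) * z) • (1 : Matrix ι ι ℂ) + (t : ℂ) • Q := by
    rw [hQ, smul_sub, smul_smul]; abel
  have hscalar : NormedSpace.exp (((t : ℂ) * z) • (1 : Matrix ι ι ℂ)) =
      Complex.exp (t * z) • (1 : Matrix ι ι ℂ) := by
    rw [← diagonal_one, ← diagonal_smul, Matrix.exp_diagonal, ← diagonal_smul]
    congr 1
    ext i
    rw [Pi.smul_apply, Pi.coe_exp, Complex.exp_eq_exp_ℂ]
    simp
  have hnil : ∀ k, m ≤ k → Q ^ k *ᵥ v = 0 := by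
    intro k hk
    rw [← Nat.sub_add_cancel hk, pow_add, ← mulVec_mulVec, hv, mulVec_zero]
  have hsum : NormedSpace.exp ((t : ℂ) • Q) *ᵥ v = ∑ k ∈ Finset.range m,
      (t : ℂ) ^ k • ((k.factorial : ℂ)⁻¹ • (Q ^ k *ᵥ v)) := by
    have h := NormedSpace.exp_series_hasSum_exp' (𝕂 := ℂ) ((t : ℂ) • Q)
    have h2 := h.map (⟨⟨fun X => X *ᵥ v, by simp⟩, fun X Y => add_mulVec X Y v⟩ :
      Matrix ι ι ℂ →+ (ι → ℂ)) (by
        change Continuous fun X : Matrix ι ι ℂ => X *ᵥ v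
        fun_prop)
    refine h2.unique ?_
    have h3 := hasSum_sum_of_ne_finset_zero (L := .unconditional ℕ) (s := Finset.range m)
      (f := fun k : ℕ =>
      (t : ℂ) ^ k • ((k.factorial : ℂ)⁻¹ • (Q ^ k *ᵥ v))) (by
        intro k hk
        rw [hnil k (by simpa using hk)]; simp)
    convert h3 using 1
    ext k : 1
    simp only [Function.comp_apply, smul_pow]
    change ((k.factorial : ℂ)⁻¹ • (t : ℂ) ^ k • Q ^ k) *ᵥ v = _
    rw [smul_mulVec, smul_mulVec, smul_comm]
  rw [hsplit, Matrix.exp_add_of_commute, hscalar, smul_mul_assoc, one_mul, smul_mulVec, hsum,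
    Finset.smul_sum]
  · refine Finset.sum_congr rfl fun k _ => ?_
    rw [smul_smul, mul_comm]
  · exact (Commute.one_left Q).smul_left _ |>.smul_right _

/-- The generalized eigenspaces span, and on each of them the exponential is an exponential
polynomial with decay rate given by the eigenvalue. -/
lemma isDecaying_exp_smul_mulVec (M : Matrix ι ι ℂ) (hM : ∀ z ∈ spectrum ℂ M, z.re < 0)
    (v : ι → ℂ) (i : ι) :
    IsDecaying fun t : ℝ => (NormedSpace.exp ((t : ℂ) • M) *ᵥ v) i := by
  let f : Module.End ℂ (ι → ℂ) := Matrix.toLin' M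
  have hv : v ∈ ⨆ z, f.maxGenEigenspace z :=
    Module.End.iSup_maxGenEigenspace_eq_top f ▸ Submodule.mem_top
  refine Submodule.iSup_induction _ (motive := fun v =>
    IsDecaying fun t : ℝ => (NormedSpace.exp ((t : ℂ) • M) *ᵥ v) i) hv ?_ ?_ ?_
  · intro z u hu
    by_cases hz : z ∈ spectrum ℂ M
    · obtain ⟨m, hm⟩ := (Module.End.mem_maxGenEigenspace _ _ _).1 hu
      have hpow : (M - z • (1 : Matrix ι ι ℂ)) ^ m *ᵥ u = 0 := by
        rw [← hm, ← Matrix.toLin'_apply, Matrix.toLin'_pow, map_sub, map_smul, Matrix.toLin'_one]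
        rfl
      simp_rw [exp_smul_mulVec_of_pow_mulVec_eq_zero M z m u hpow, Finset.sum_apply, Pi.smul_apply]
      refine IsDecaying.sum _ fun k _ => ?_
      exact (isDecaying_pow_mul_exp z (hM z hz) k).mul_const _
    · have hbot : f.maxGenEigenspace z = ⊥ := by
        by_contra hne
        have hev : f.HasEigenvalue z :=
          Module.End.HasUnifEigenvalue.lt (k := ⊤) zero_lt_one hne
        exact hz (Matrix.spectrum_toLin' (R := ℂ) M ▸ hev.mem_spectrum)
      rw [hbot, Submodule.mem_bot] at hu
      simpa [hu] using IsDecaying.zero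
  · simpa using IsDecaying.zero
  · intro u u' hu hu'
    simpa [mulVec_add] using hu.add hu'

lemma isDecaying_exp_smul_apply (M : Matrix ι ι ℂ) (hM : ∀ z ∈ spectrum ℂ M, z.re < 0)
    (i j : ι) : IsDecaying fun t : ℝ => NormedSpace.exp ((t : ℂ) • M) i j := by
  simpa [mulVec_single_one] using isDecaying_exp_smul_mulVec M hM (Pi.single j 1) i

/-- The Laplace transform of `exp (tM)` on the imaginary axis is the resolvent of `M`. -/
lemma sub_mul_laplace_exp (M : Matrix ι ι ℂ) (hM : ∀ z ∈ spectrum ℂ M, z.re < 0) (ω : ℝ) :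
    ((Complex.I * ω) • (1 : Matrix ι ι ℂ) - M) * (Matrix.of fun i j =>
      ∫ t in Ioi (0 : ℝ), NormedSpace.exp ((t : ℂ) • M) i j * Complex.exp (-(Complex.I * ω * t))) =
      1 := by
  set E : ℝ → Matrix ι ι ℂ := fun t => NormedSpace.exp ((t : ℂ) • M) with hE
  set e : ℝ → ℂ := fun t => Complex.exp (-(Complex.I * ω * t)) with he
  have henorm : ∀ t, ‖e t‖ = 1 := by
    intro t
    rw [he]
    simp [Complex.norm_exp]
  have hecont : Continuous e := by fun_prop
  have hderiv : ∀ t : ℝ, HasDerivAt E (M * E t) t := by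
    intro t
    have h := HasDerivAt.scomp (h := fun s : ℝ => (s : ℂ)) t
      (hasDerivAt_exp_smul_const' (𝕂 := ℂ) M (t : ℂ)) Complex.ofRealCLM.hasDerivAt
    exact h.congr_deriv (by simp only [Complex.ofRealCLM_apply, Complex.ofReal_one, one_smul]; rfl)
  have hederiv : ∀ t : ℝ, HasDerivAt e (e t * (-(Complex.I * ω))) t := by
    intro t
    have h : HasDerivAt (fun t : ℝ => -(Complex.I * ω * t)) (-(Complex.I * ω)) t := by
      exact ((Complex.ofRealCLM.hasDerivAt (x := t)).const_mul (Complex.I * ω)).neg.congr_deriv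
        (by simp)
    exact h.cexp
  have hint : ∀ i j, IntegrableOn (fun t => E t i j * e t) (Ioi 0) := by
    intro i j
    refine ((isDecaying_exp_smul_apply M hM i j).1).mul_bdd (c := 1)
      hecont.aestronglyMeasurable ?_
    exact Eventually.of_forall fun t => (henorm t).le
  ext i j
  have hentry : ∀ t, HasDerivAt (fun t => E t i j) ((M * E t) i j) t := fun t =>
    (hasDerivAt_pi.1 ((hasDerivAt_pi.1 (hderiv t)) i)) j
  -- `-exp (t(M - iω))` is a primitive of `(iω - M) exp (t(M - iω))`, with value `-1` at `0`.
  have hd : ∀ t : ℝ, HasDerivAt (fun t => -(E t i j * e t))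
      (∑ k, ((Complex.I * ω) • (1 : Matrix ι ι ℂ) - M) i k * (E t k j * e t)) t := by
    intro t
    refine ((hentry t).mul (hederiv t)).neg.congr_deriv ?_
    have : ∑ k, ((Complex.I * ω) • (1 : Matrix ι ι ℂ) - M) i k * (E t k j * e t) =
        (((Complex.I * ω) • (1 : Matrix ι ι ℂ) - M) * E t) i j * e t := by
      rw [mul_apply, Finset.sum_mul]
      exact Finset.sum_congr rfl fun k _ => by ring
    rw [this, sub_mul, smul_mul_assoc, one_mul, Matrix.sub_apply, Matrix.smul_apply,
      smul_eq_mul]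
    ring
  have hlim : Tendsto (fun t => -(E t i j * e t)) atTop (𝓝 0) := by
    refine tendsto_zero_iff_norm_tendsto_zero.2 ?_
    simpa only [norm_neg, norm_mul, henorm, mul_one, norm_zero] using
      (isDecaying_exp_smul_apply M hM i j).2.norm
  have hI := integral_Ioi_of_hasDerivAt_of_tendsto' (a := 0) (fun t _ => hd t)
    (integrable_finsetSum _ fun k _ => (hint k j).const_mul _) hlim
  rw [integral_finsetSum _ fun k _ => (hint k j).const_mul _] at hI
  simp_rw [integral_const_mul] at hI
  rw [mul_apply]
  simp only [of_apply]
  rw [hI]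
  simp [hE, he]

end MatrixExponential

/-! ### Variation of constants for Carathéodory solutions -/

section VariationOfConstants

/-- A primitive of an integrable function is absolutely continuous, and the function is its
derivative almost everywhere. -/
lemma absolutelyContinuous_and_deriv_of_primitive {u u' : ℝ → ℝ} {s t : ℝ}
    (hu' : IntervalIntegrable u' volume s t) (hu : ∀ r, u r - u s = ∫ q in s..r, u' q) :
    AbsolutelyContinuousOnInterval u s t ∧ ∀ᵐ r, r ∈ uIcc s t → deriv u r = u' r := by
  have hu_eq : u = fun r => u s + ∫ q in s..r, u' q := funext fun r => by rw [← hu r]; ring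
  rw [hu_eq]
  generalize u s = a
  constructor
  · exact contDiffOn_const.absolutelyContinuousOnInterval.add
      (hu'.absolutelyContinuousOnInterval_intervalIntegral left_mem_uIcc)
  · filter_upwards [hu'.ae_hasDerivAt_integral] with r hr hrm
    exact ((hr hrm s left_mem_uIcc).const_add _).deriv

/-- Integration by parts for two primitives of integrable functions. -/
lemma integral_parts_of_primitive {u u' v v' : ℝ → ℝ} {s t : ℝ}
    (hu' : IntervalIntegrable u' volume s t) (hu : ∀ r, u r - u s = ∫ q in s..r, u' q)
    (hv' : IntervalIntegrable v' volume s t) (hv : ∀ r, v r - v s = ∫ q in s..r, v' q) :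
    ∫ r in s..t, (u' r * v r + u r * v' r) = u t * v t - u s * v s := by
  obtain ⟨hua, hud⟩ := absolutelyContinuous_and_deriv_of_primitive hu' hu
  obtain ⟨hva, hvd⟩ := absolutelyContinuous_and_deriv_of_primitive hv' hv
  rw [← hua.integral_deriv_mul_eq_sub hva]
  refine intervalIntegral.integral_congr_ae ?_
  filter_upwards [hud, hvd] with r hr hr' hrm
  rw [hr (uIoc_subset_uIcc hrm), hr' (uIoc_subset_uIcc hrm)]

variable {ι κ : Type*} [Fintype ι]

lemma IsSolutionPath.intervalIntegrable_input [Fintype κ] {M : Matrix ι ι ℝ} {B : Matrix ι κ ℝ}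
    {u : ℝ → κ → ℝ} {ξ : ℝ → ι → ℝ} (h : IsSolutionPath M B u ξ) (k : κ) (a b : ℝ) :
    IntervalIntegrable (fun r => u r k) volume a b := by
  have h1 := h.input_integrable.integrableOn_isCompact (isCompact_uIcc (a := a) (b := b))
  have h2 : IntervalIntegrable u volume a b :=
    intervalIntegrable_iff.2 (h1.mono_set uIoc_subset_uIcc)
  exact ⟨h2.1.eval k, h2.2.eval k⟩

variable [DecidableEq ι]

lemma hasDerivAt_exp_sub_smul_apply (M : Matrix ι ι ℝ) (t r : ℝ) (i j : ι) :
    HasDerivAt (fun r => NormedSpace.exp ((t - r) • M) i j)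
      (-(NormedSpace.exp ((t - r) • M) * M) i j) r := by
  open scoped Matrix.Norms.Operator in
  have h := HasDerivAt.scomp (h := fun r : ℝ => t - r) r
      (hasDerivAt_exp_smul_const (𝕂 := ℝ) M (t - r)) ((hasDerivAt_id r).const_sub t)
  have h2 := (hasDerivAt_pi.1 ((hasDerivAt_pi.1 h) i)) j
  exact h2.congr_deriv (by simp only [neg_smul, one_smul]; rfl)

lemma continuous_exp_smul (M : Matrix ι ι ℝ) :
    Continuous fun t : ℝ => NormedSpace.exp (t • M) := by
  open scoped Matrix.Norms.Operator in
  exact NormedSpace.exp_continuous.comp (continuous_id.smul continuous_const)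

/-- A Carathéodory solution is only absolutely continuous, so the derivative of
`exp ((t - r)M) ξ(r)` is integrated entry by entry, through integration by parts. -/
lemma IsSolutionPath.variation_of_constants [Fintype κ] {M : Matrix ι ι ℝ} {B : Matrix ι κ ℝ}
    {u : ℝ → κ → ℝ} {ξ : ℝ → ι → ℝ} (h : IsSolutionPath M B u ξ) (s t : ℝ) :
    ξ t = NormedSpace.exp ((t - s) • M) *ᵥ ξ s +
      fun i => ∫ r in s..t, (NormedSpace.exp ((t - r) • M) *ᵥ (B *ᵥ u r)) i := by
  set E : ℝ → Matrix ι ι ℝ := fun r => NormedSpace.exp ((t - r) • M) with hE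
  have hEcont : Continuous E := (continuous_exp_smul M).comp (continuous_const.sub continuous_id)
  have hEij : ∀ i j, Continuous fun r => E r i j := fun i j => hEcont.matrix_elem i j
  have hξj : ∀ j, Continuous fun r => ξ r j := fun j => (continuous_apply j).comp h.continuous
  have hBu : ∀ j a b, IntervalIntegrable (fun r => (B *ᵥ u r) j) volume a b := fun j a b => by
    simp only [mulVec, dotProduct]
    simpa only [Finset.sum_fn] using
      IntervalIntegrable.sum Finset.univ fun k _ =>
        (h.intervalIntegrable_input k a b).const_mul (B j k)
  have hMξ : ∀ j, Continuous fun r => (M *ᵥ ξ r) j := fun j =>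
    (continuous_apply j).comp (continuous_const.matrix_mulVec h.continuous)
  have hrhs : ∀ j a b, IntervalIntegrable (fun r => (M *ᵥ ξ r) j + (B *ᵥ u r) j) volume a b :=
    fun j a b => ((hMξ j).intervalIntegrable a b).add (hBu j a b)
  have hprim : ∀ j r, ξ r j - ξ s j = ∫ q in s..r, ((M *ᵥ ξ q) j + (B *ᵥ u q) j) := by
    intro j r
    have h1 := congrFun (h.integral_eq s r) j
    have hint : IntervalIntegrable (fun q => M *ᵥ ξ q + B *ᵥ u q) volume s r :=
      ⟨Integrable.of_eval fun j => (hrhs j s r).1, Integrable.of_eval fun j => (hrhs j s r).2⟩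
    rw [Pi.sub_apply] at h1
    rw [h1]
    exact ((ContinuousLinearMap.proj (R := ℝ) (φ := fun _ : ι => ℝ) j).intervalIntegral_comp_comm
      hint).symm
  have hEM : ∀ i j, Continuous fun r => -(E r * M) i j := fun i j =>
    ((hEcont.matrix_mul continuous_const).matrix_elem i j).neg
  ext i
  have hparts : ∀ j, ∫ r in s..t, (-(E r * M) i j * ξ r j +
      E r i j * ((M *ᵥ ξ r) j + (B *ᵥ u r) j)) = E t i j * ξ t j - E s i j * ξ s j := by
    intro j
    refine integral_parts_of_primitive ((hEM i j).intervalIntegrable s t) (fun r => ?_)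
      (hrhs j s t) (hprim j)
    exact (intervalIntegral.integral_eq_sub_of_hasDerivAt
      (fun q _ => hasDerivAt_exp_sub_smul_apply M t q i j)
      ((hEM i j).intervalIntegrable s r)).symm
  have hsum : ∫ r in s..t, (E r *ᵥ (B *ᵥ u r)) i =
      ∑ j, ∫ r in s..t, (-(E r * M) i j * ξ r j +
        E r i j * ((M *ᵥ ξ r) j + (B *ᵥ u r) j)) := by
    rw [← intervalIntegral.integral_finsetSum]
    · refine intervalIntegral.integral_congr fun r _ => ?_
      have h1 : ∑ j, (E r * M) i j * ξ r j = ∑ j, E r i j * (M *ᵥ ξ r) j :=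
        congrFun (mulVec_mulVec (ξ r) (E r) M).symm i
      simp only [neg_mul, mul_add, Finset.sum_add_distrib, Finset.sum_neg_distrib, h1]
      rw [neg_add_cancel_left]
      rfl
    · intro j _
      exact (((hEM i j).mul (hξj j)).intervalIntegrable s t).add
        ((hrhs j s t).continuousOn_mul (hEij i j).continuousOn)
  have hEt : E t = 1 := by simp [hE]
  rw [Pi.add_apply, hsum, Finset.sum_congr rfl fun j _ => hparts j, Finset.sum_sub_distrib]
  have h1 : ∑ j, E t i j * ξ t j = ξ t i := by
    rw [hEt]; exact congrFun (one_mulVec (ξ t)) i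
  rw [h1]
  change _ = ∑ j, E s i j * ξ s j + _
  ring

end VariationOfConstants

/-! ### Integrable filters driven by uncorrelated wide-sense stationary inputs -/

section Filtering

/-- The correlation function at lag `τ` of the responses of two filters with impulse responses
`a` and `a'` to one common input with autocorrelation function `R`. -/
noncomputable def filteredCorrelation (a a' R : ℝ → ℝ) (τ : ℝ) : ℝ :=
  ∫ p : ℝ × ℝ, a p.1 * a' p.2 * R (τ + p.2 - p.1)

section Spectrum

variable {a a' R : ℝ → ℝ}

lemma norm_cexp_neg_I_mul (ω τ : ℝ) : ‖Complex.exp (-(Complex.I * ω * τ))‖ = 1 := by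
  simp [Complex.norm_exp]

lemma continuous_cexp_neg_I_mul (ω : ℝ) :
    Continuous fun τ : ℝ => Complex.exp (-(Complex.I * ω * τ)) := by
  fun_prop

lemma integrable_filteredCorrelation_integrand (ha : Integrable a) (ha' : Integrable a')
    (hR : Integrable R) (hRm : Measurable R) :
    Integrable fun q : ℝ × ℝ × ℝ => a q.2.1 * a' q.2.2 * R (q.1 + q.2.2 - q.2.1) := by
  have hmeas : AEStronglyMeasurable
      (fun q : ℝ × ℝ × ℝ => a q.2.1 * a' q.2.2 * R (q.1 + q.2.2 - q.2.1)) := by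
    have h1 : AEStronglyMeasurable (fun q : ℝ × ℝ × ℝ => a q.2.1 * a' q.2.2) :=
      (ha.mul_prod ha').aestronglyMeasurable.comp_snd
    exact h1.mul (Measurable.aestronglyMeasurable (by fun_prop))
  refine (integrable_prod_iff' hmeas).2 ⟨Eventually.of_forall fun p => ?_, ?_⟩
  · have h := (hR.comp_add_right (p.2 - p.1)).const_mul (a p.1 * a' p.2)
    simpa only [add_sub_assoc] using h
  · have h := ((ha.mul_prod ha').norm).mul_const (∫ σ, ‖R σ‖)
    refine h.congr (Eventually.of_forall fun p => ?_)
    simp only [norm_mul (a p.1 * a' p.2), integral_const_mul, add_sub_assoc]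
    rw [integral_add_right_eq_self (fun σ => ‖R σ‖)]

lemma integrable_filteredCorrelation (ha : Integrable a) (ha' : Integrable a')
    (hR : Integrable R) (hRm : Measurable R) : Integrable (filteredCorrelation a a' R) :=
  (integrable_filteredCorrelation_integrand ha ha' hR hRm).integral_prod_left

lemma conj_spectralDensity (a : ℝ → ℝ) (ω : ℝ) :
    conj (spectralDensity a ω) = ∫ r : ℝ, (a r : ℂ) * Complex.exp (Complex.I * ω * r) := by
  rw [spectralDensity, ← integral_conj]
  refine integral_congr_ae (Eventually.of_forall fun r => ?_)
  simp [← Complex.exp_conj]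

/-- Wiener–Khinchin: filtering multiplies the spectrum by one frequency response and by the
conjugate of the other. -/
lemma spectralDensity_filteredCorrelation (ha : Integrable a) (ha' : Integrable a')
    (hR : Integrable R) (hRm : Measurable R) (ω : ℝ) :
    spectralDensity (filteredCorrelation a a' R) ω =
      spectralDensity R ω * (spectralDensity a ω * conj (spectralDensity a' ω)) := by
  have hint : Integrable (Function.uncurry fun (τ : ℝ) (p : ℝ × ℝ) =>
      ((a p.1 * a' p.2 * R (τ + p.2 - p.1) : ℝ) : ℂ) * Complex.exp (-(Complex.I * ω * τ)))
      (volume.prod volume) := by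
    refine (integrable_filteredCorrelation_integrand ha ha' hR hRm).ofReal.mul_bdd (c := 1)
      ((continuous_cexp_neg_I_mul ω).comp continuous_fst).aestronglyMeasurable ?_
    exact Eventually.of_forall fun q => (norm_cexp_neg_I_mul ω q.1).le
  have hshift : ∀ p : ℝ × ℝ, ∫ τ : ℝ, ((a p.1 * a' p.2 * R (τ + p.2 - p.1) : ℝ) : ℂ) *
      Complex.exp (-(Complex.I * ω * τ)) =
      ((a p.1 : ℂ) * Complex.exp (-(Complex.I * ω * p.1))) *
        ((a' p.2 : ℂ) * Complex.exp (Complex.I * ω * p.2)) * spectralDensity R ω := by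
    intro p
    rw [spectralDensity, ← integral_add_right_eq_self
      (fun σ : ℝ => (R σ : ℂ) * Complex.exp (-(Complex.I * ω * σ))) (p.2 - p.1),
      ← integral_const_mul]
    refine integral_congr_ae (Eventually.of_forall fun τ => ?_)
    have he : Complex.exp (-(Complex.I * ω * τ)) = Complex.exp (-(Complex.I * ω * p.1)) *
        Complex.exp (Complex.I * ω * p.2) *
        Complex.exp (-(Complex.I * ω * (τ + (p.2 - p.1) : ℝ))) := by
      rw [← Complex.exp_add, ← Complex.exp_add]
      congr 1
      push_cast
      ring
    simp only [he, add_sub_assoc]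
    push_cast
    ring
  have h1 : spectralDensity (filteredCorrelation a a' R) ω = ∫ τ : ℝ, ∫ p : ℝ × ℝ,
      ((a p.1 * a' p.2 * R (τ + p.2 - p.1) : ℝ) : ℂ) * Complex.exp (-(Complex.I * ω * τ)) := by
    rw [spectralDensity]
    refine integral_congr_ae (Eventually.of_forall fun τ => ?_)
    simp only [filteredCorrelation]
    rw [integral_mul_const, integral_complex_ofReal]
  rw [h1, integral_integral_swap hint]
  simp_rw [hshift]
  rw [integral_mul_const, Measure.volume_eq_prod,
    integral_prod_mul (fun s : ℝ => (a s : ℂ) * Complex.exp (-(Complex.I * ω * s)))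
      (fun r : ℝ => (a' r : ℂ) * Complex.exp (Complex.I * ω * r)),
    conj_spectralDensity, mul_comm]
  rfl

end Spectrum

section Moments

variable {S κ : Type*} [MeasurableSpace S] {μ : Measure S}
  {w : ℝ → S → κ → ℝ} {R : ℝ → ℝ} {a a' : ℝ → ℝ}

lemma IsUncorrelatedWSSInput.integral_sq (hw : IsUncorrelatedWSSInput μ w R) (k : κ) (t : ℝ) :
    ∫ o, w t o k ^ 2 ∂μ = R 0 := by
  rw [← hw.autocorr k t 0]
  simp [component, sq]

lemma IsUncorrelatedWSSInput.integrable_mul (hw : IsUncorrelatedWSSInput μ w R) (k l : κ)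
    (s t : ℝ) : Integrable (fun o => w s o k * w t o l) μ :=
  (hw.memLp k s).integrable_mul (hw.memLp l t)

/-- The uniform bound that makes Fubini's theorem applicable to products of filtered inputs. -/
lemma IsUncorrelatedWSSInput.integral_norm_mul_le (hw : IsUncorrelatedWSSInput μ w R) (k l : κ)
    (s t : ℝ) : ∫ o, ‖w s o k * w t o l‖ ∂μ ≤ R 0 := by
  have h1 : Integrable (fun o => w s o k ^ 2) μ := (hw.memLp k s).integrable_sq
  have h2 : Integrable (fun o => w t o l ^ 2) μ := (hw.memLp l t).integrable_sq
  have h3 : ∫ o, (w s o k ^ 2 + w t o l ^ 2) / 2 ∂μ = R 0 := by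
    rw [integral_div, integral_add h1 h2, hw.integral_sq, hw.integral_sq]
    ring
  rw [← h3]
  refine integral_mono (hw.integrable_mul k l s t).norm ((h1.add h2).div_const 2) fun o => ?_
  simp only [norm_mul, Real.norm_eq_abs]
  nlinarith [sq_nonneg (|w s o k| - |w t o l|), sq_abs (w s o k), sq_abs (w t o l)]

lemma IsUncorrelatedWSSInput.measurable_shift (hw : IsUncorrelatedWSSInput μ w R) (k : κ) (t : ℝ) :
    Measurable fun p : ℝ × S => w (t - p.1) p.2 k :=
  (hw.measurable k).comp ((measurable_const.sub measurable_fst).prodMk measurable_snd)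

variable [IsProbabilityMeasure μ]

lemma IsUncorrelatedWSSInput.measurable_autocorr (hw : IsUncorrelatedWSSInput μ w R) (k : κ) :
    Measurable R := by
  have hR : R = fun τ => ∫ o, w 0 o k * w τ o k ∂μ := by
    ext τ
    rw [← hw.autocorr k 0 τ]
    simp [component]
  have h0 : Measurable fun o => w 0 o k := (hw.measurable k).comp measurable_prodMk_left
  have h : StronglyMeasurable (Function.uncurry fun τ o => w 0 o k * w τ o k) :=
    ((h0.comp measurable_snd).mul (hw.measurable k)).stronglyMeasurable
  rw [hR]
  exact h.integral_prod_right.measurable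

lemma IsUncorrelatedWSSInput.integrable_filter (hw : IsUncorrelatedWSSInput μ w R)
    (ha : Integrable a) (k : κ) (t : ℝ) :
    Integrable (fun p : ℝ × S => a p.1 * w (t - p.1) p.2 k) (volume.prod μ) := by
  have hmeas : AEStronglyMeasurable (fun p : ℝ × S => a p.1 * w (t - p.1) p.2 k)
      (volume.prod μ) :=
    ha.aestronglyMeasurable.comp_fst.mul (hw.measurable_shift k t).aestronglyMeasurable
  have hwi : ∀ s, Integrable (fun o => w s o k) μ := fun s => (hw.memLp k s).integrable one_le_two
  refine (integrable_prod_iff hmeas).2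
    ⟨Eventually.of_forall fun s => (hwi (t - s)).const_mul (a s), ?_⟩
  refine (ha.norm.mul_const (R 0 + 1)).mono' hmeas.norm.integral_prod_right' ?_
  refine Eventually.of_forall fun s => ?_
  have hbound : ∫ o, ‖w (t - s) o k‖ ∂μ ≤ R 0 + 1 := by
    have h1 : Integrable (fun o => w (t - s) o k ^ 2) μ := (hw.memLp k _).integrable_sq
    have h2 : ∫ o, (w (t - s) o k ^ 2 + 1) ∂μ = R 0 + 1 := by
      rw [integral_add h1 (integrable_const _), hw.integral_sq]
      simp
    rw [← h2]
    refine integral_mono (hwi _).norm (h1.add (integrable_const _)) fun o => ?_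
    simp only [Real.norm_eq_abs]
    nlinarith [sq_nonneg (|w (t - s) o k| - 1), sq_abs (w (t - s) o k)]
  simp only [norm_mul (a s), integral_const_mul]
  rw [Real.norm_of_nonneg (by positivity)]
  exact mul_le_mul_of_nonneg_left hbound (norm_nonneg _)

lemma IsUncorrelatedWSSInput.integral_filter (hw : IsUncorrelatedWSSInput μ w R)
    (ha : Integrable a) (k : κ) (t : ℝ) :
    ∫ o, (∫ s, a s * w (t - s) o k) ∂μ = 0 := by
  rw [integral_integral_swap (f := fun o s => a s * w (t - s) o k)
    (hw.integrable_filter ha k t).swap]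
  simp_rw [integral_const_mul]
  have h : ∀ s, ∫ o, w (t - s) o k ∂μ = 0 := fun s => hw.mean_zero k (t - s)
  simp [h]

lemma IsUncorrelatedWSSInput.integrable_filter_mul_filter (hw : IsUncorrelatedWSSInput μ w R)
    (ha : Integrable a) (ha' : Integrable a') (k l : κ) (t t' : ℝ) :
    Integrable (fun q : (ℝ × ℝ) × S =>
      (a q.1.1 * w (t - q.1.1) q.2 k) * (a' q.1.2 * w (t' - q.1.2) q.2 l))
      ((volume.prod volume).prod μ) := by
  have hmeas : AEStronglyMeasurable (fun q : (ℝ × ℝ) × S =>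
      (a q.1.1 * a' q.1.2) * (w (t - q.1.1) q.2 k * w (t' - q.1.2) q.2 l))
      ((volume.prod volume).prod μ) := by
    refine (ha.mul_prod ha').aestronglyMeasurable.comp_fst.mul
      (Measurable.aestronglyMeasurable ?_)
    exact ((hw.measurable_shift k t).comp
      ((measurable_fst.comp measurable_fst).prodMk measurable_snd)).mul
      ((hw.measurable_shift l t').comp
      ((measurable_snd.comp measurable_fst).prodMk measurable_snd))
  have h : Integrable (fun q : (ℝ × ℝ) × S =>
      (a q.1.1 * a' q.1.2) * (w (t - q.1.1) q.2 k * w (t' - q.1.2) q.2 l))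
      ((volume.prod volume).prod μ) := by
    refine (integrable_prod_iff hmeas).2
      ⟨Eventually.of_forall fun p =>
        (hw.integrable_mul k l (t - p.1) (t' - p.2)).const_mul (a p.1 * a' p.2), ?_⟩
    refine ((ha.mul_prod ha').norm.mul_const (R 0)).mono' hmeas.norm.integral_prod_right' ?_
    refine Eventually.of_forall fun p => ?_
    simp only [norm_mul (a p.1 * a' p.2), integral_const_mul]
    rw [Real.norm_of_nonneg (by positivity)]
    exact mul_le_mul_of_nonneg_left (hw.integral_norm_mul_le k l _ _) (norm_nonneg _)
  refine h.congr (Eventually.of_forall fun q => ?_)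
  ring

lemma IsUncorrelatedWSSInput.integrable_filter_mul (hw : IsUncorrelatedWSSInput μ w R)
    (ha : Integrable a) (ha' : Integrable a') (k l : κ) (t t' : ℝ) :
    Integrable (fun o => (∫ s, a s * w (t - s) o k) * ∫ r, a' r * w (t' - r) o l) μ := by
  refine (hw.integrable_filter_mul_filter ha ha' k l t t').integral_prod_right.congr ?_
  refine Eventually.of_forall fun o => ?_
  exact integral_prod_mul (fun s => a s * w (t - s) o k) (fun r => a' r * w (t' - r) o l)

lemma IsUncorrelatedWSSInput.integral_filter_mul (hw : IsUncorrelatedWSSInput μ w R)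
    (ha : Integrable a) (ha' : Integrable a') (k l : κ) (t t' : ℝ) :
    ∫ o, (∫ s, a s * w (t - s) o k) * (∫ r, a' r * w (t' - r) o l) ∂μ =
      ∫ p : ℝ × ℝ, a p.1 * a' p.2 * ∫ o, w (t - p.1) o k * w (t' - p.2) o l ∂μ := by
  have h := integral_integral_swap
    (f := fun o (p : ℝ × ℝ) => (a p.1 * w (t - p.1) o k) * (a' p.2 * w (t' - p.2) o l))
    (hw.integrable_filter_mul_filter ha ha' k l t t').swap
  calc _ = ∫ o, (∫ p : ℝ × ℝ, (a p.1 * w (t - p.1) o k) * (a' p.2 * w (t' - p.2) o l)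
        ∂(volume.prod volume)) ∂μ :=
        integral_congr_ae (Eventually.of_forall fun o =>
          (integral_prod_mul (fun s => a s * w (t - s) o k) (fun r => a' r * w (t' - r) o l)).symm)
    _ = _ := h
    _ = _ := by
        refine integral_congr_ae (Eventually.of_forall fun p => ?_)
        simp only
        rw [← integral_const_mul]
        refine integral_congr_ae (Eventually.of_forall fun o => ?_)
        ring

lemma IsUncorrelatedWSSInput.integral_filter_mul_self (hw : IsUncorrelatedWSSInput μ w R)
    (ha : Integrable a) (ha' : Integrable a') (k : κ) (t τ : ℝ) :
    ∫ o, (∫ s, a s * w (t - s) o k) * (∫ r, a' r * w (t - τ - r) o k) ∂μ =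
      filteredCorrelation a a' R τ := by
  rw [hw.integral_filter_mul ha ha']
  refine integral_congr_ae (Eventually.of_forall fun p => ?_)
  simp only
  rw [← hw.autocorr k (t - τ - p.2) (τ + p.2 - p.1)]
  congr 1
  refine integral_congr_ae (Eventually.of_forall fun o => ?_)
  simp only [component]
  rw [mul_comm]
  congr 3
  ring

lemma IsUncorrelatedWSSInput.integral_filter_mul_of_ne (hw : IsUncorrelatedWSSInput μ w R)
    (ha : Integrable a) (ha' : Integrable a') {k l : κ} (hkl : k ≠ l) (t t' : ℝ) :
    ∫ o, (∫ s, a s * w (t - s) o k) * (∫ r, a' r * w (t' - r) o l) ∂μ = 0 := by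
  rw [hw.integral_filter_mul ha ha']
  have h : ∀ s t, ∫ o, w s o k * w t o l ∂μ = 0 := fun s t => hw.uncorr k l hkl s t
  simp [h]

end Moments

section Response

variable {S ι κ : Type*} [MeasurableSpace S] [Fintype κ] {μ : Measure S}

/-- `y` is the response to `w` of the linear time-invariant filter with the integrable impulse
responses `g i k`: at each time, `y_i` is almost surely the convolution `∑ₖ g_{ik} ∗ w_k`. -/
structure IsFilterResponse (μ : Measure S) (g : ι → κ → ℝ → ℝ) (w : ℝ → S → κ → ℝ)
    (y : ℝ → S → ι → ℝ) : Prop where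
  integrable : ∀ i k, Integrable (g i k)
  memLp : ∀ i t, MemLp (component y i t) 2 μ
  eq_conv : ∀ i t, ∀ᵐ o ∂μ, y t o i = ∑ k, ∫ s, g i k s * w (t - s) o k

variable [IsProbabilityMeasure μ] {g : ι → κ → ℝ → ℝ} {w : ℝ → S → κ → ℝ} {y : ℝ → S → ι → ℝ}
  {R : ℝ → ℝ}

lemma IsFilterResponse.mean_zero (h : IsFilterResponse μ g w y)
    (hw : IsUncorrelatedWSSInput μ w R) (i : ι) (t : ℝ) : ∫ o, component y i t o ∂μ = 0 := by
  have hi := h.eq_conv i t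
  change ∫ o, y t o i ∂μ = 0
  rw [integral_congr_ae hi, integral_finsetSum]
  · exact Finset.sum_eq_zero fun k _ => hw.integral_filter (h.integrable i k) k t
  · exact fun k _ => (hw.integrable_filter (h.integrable i k) k t).integral_prod_right

lemma IsFilterResponse.correlation (h : IsFilterResponse μ g w y)
    (hw : IsUncorrelatedWSSInput μ w R) (i j : ι) (t τ : ℝ) :
    ∫ o, component y i t o * component y j (t - τ) o ∂μ =
      ∑ k, filteredCorrelation (g i k) (g j k) R τ := by
  have hint : ∀ k l, Integrable (fun o => (∫ s, g i k s * w (t - s) o k) *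
      ∫ r, g j l r * w (t - τ - r) o l) μ := fun k l =>
    hw.integrable_filter_mul (h.integrable i k) (h.integrable j l) k l t (t - τ)
  have hcongr : ∀ᵐ o ∂μ, component y i t o * component y j (t - τ) o =
      ∑ k, ∑ l, (∫ s, g i k s * w (t - s) o k) * ∫ r, g j l r * w (t - τ - r) o l := by
    filter_upwards [h.eq_conv i t, h.eq_conv j (t - τ)] with o h1 h2
    rw [component, component, h1, h2, Finset.sum_mul_sum]
  rw [integral_congr_ae hcongr,
    integral_finsetSum _ fun k _ => integrable_finsetSum _ fun l _ => hint k l]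
  refine Finset.sum_congr rfl fun k _ => ?_
  rw [integral_finsetSum _ fun l _ => hint k l, Finset.sum_eq_single k]
  · exact hw.integral_filter_mul_self (h.integrable i k) (h.integrable j k) k t τ
  · intro l _ hl
    exact hw.integral_filter_mul_of_ne (h.integrable i k) (h.integrable j l) hl.symm t (t - τ)
  · simp

lemma IsFilterResponse.crossCorrelation_eq (h : IsFilterResponse μ g w y)
    (hw : IsUncorrelatedWSSInput μ w R) (i j : ι) :
    crossCorrelation μ (component y i) (component y j) =
      fun τ => ∑ k, filteredCorrelation (g i k) (g j k) R τ :=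
  funext fun τ => h.correlation hw i j 0 τ

lemma IsFilterResponse.isJointlyWSS (h : IsFilterResponse μ g w y)
    (hw : IsUncorrelatedWSSInput μ w R) : IsJointlyWSS μ y where
  memLp := h.memLp
  mean i s t := by rw [h.mean_zero hw, h.mean_zero hw]
  corr i j t τ := by rw [h.correlation hw, h.crossCorrelation_eq hw]

lemma IsFilterResponse.integrable_crossCorrelation (h : IsFilterResponse μ g w y)
    (hw : IsUncorrelatedWSSInput μ w R) (hR : Integrable R) (i j : ι) :
    Integrable (crossCorrelation μ (component y i) (component y j)) := by
  rw [h.crossCorrelation_eq hw]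
  exact integrable_finsetSum _ fun k _ => integrable_filteredCorrelation (h.integrable i k)
    (h.integrable j k) hR (hw.measurable_autocorr k)

/-- The spectral matrix of the response to mutually uncorrelated inputs is `S_w Ĝ Ĝᴴ`, where
`Ĝ` is the matrix of frequency responses. -/
lemma IsFilterResponse.cpsdMatrix_eq (h : IsFilterResponse μ g w y)
    (hw : IsUncorrelatedWSSInput μ w R) (hR : Integrable R) (ω : ℝ) :
    cpsdMatrix μ y ω = spectralDensity R ω •
      ((Matrix.of fun i k => spectralDensity (g i k) ω) *
        (Matrix.of fun i k => spectralDensity (g i k) ω)ᴴ) := by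
  ext i j
  simp only [cpsdMatrix, crossPowerSpectralDensity, of_apply, h.crossCorrelation_eq hw,
    Matrix.smul_apply, mul_apply, conjTranspose_apply, smul_eq_mul, Finset.mul_sum]
  have hk : ∀ k, Integrable fun τ : ℝ => (filteredCorrelation (g i k) (g j k) R τ : ℂ) *
      Complex.exp (-(Complex.I * ω * τ)) := fun k =>
    (integrable_filteredCorrelation (h.integrable i k) (h.integrable j k) hR
      (hw.measurable_autocorr k)).ofReal.mul_bdd (c := 1)
      (continuous_cexp_neg_I_mul ω).aestronglyMeasurable
      (Eventually.of_forall fun τ => (norm_cexp_neg_I_mul ω τ).le)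
  calc _ = ∑ k, spectralDensity (filteredCorrelation (g i k) (g j k) R) ω := by
        simp only [spectralDensity]
        rw [← integral_finsetSum _ fun k _ => hk k]
        refine integral_congr_ae (Eventually.of_forall fun τ => ?_)
        simp only [Complex.ofReal_sum, Finset.sum_mul]
    _ = _ := Finset.sum_congr rfl fun k _ =>
        spectralDensity_filteredCorrelation (h.integrable i k) (h.integrable j k) hR
          (hw.measurable_autocorr k) ω

end Response

end Filtering

/-! ### The closed-loop transfer matrix -/

section TransferMatrix

variable {N n : ℕ}

/-- Entrywise inclusion of real matrices into complex ones. -/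
abbrev toComplex {ι κ : Type*} (M : Matrix ι κ ℝ) : Matrix ι κ ℂ := M.map (fun r : ℝ => (r : ℂ))

lemma networkStateMatrix_apply (A : Matrix (Fin n) (Fin n) ℝ) (b c : Fin n → ℝ)
    (G : Matrix (Fin N) (Fin N) ℝ) (k m : Fin N) (p q : Fin n) :
    networkStateMatrix A b c G (k, p) (m, q) =
      (1 : Matrix (Fin N) (Fin N) ℝ) k m * A p q + G k m * (b p * c q) := rfl

lemma networkInputMatrix_apply (b : Fin n → ℝ) (k m : Fin N) (p : Fin n) :
    networkInputMatrix N b (k, p) m = (1 : Matrix (Fin N) (Fin N) ℝ) k m * b p := rfl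

lemma networkOutputMatrix_apply (c : Fin n → ℝ) (k m : Fin N) (q : Fin n) :
    networkOutputMatrix N c k (m, q) = (1 : Matrix (Fin N) (Fin N) ℝ) k m * c q := rfl

/-- If `X` solves `(s - M) X = B` for the network matrices, then `H = C X` satisfies the feedback
equation `H = h(s) (1 + G H)`, which inverts the loop: `(1 / h(s) - G) H = 1`. -/
lemma loop_inverse (A : Matrix (Fin n) (Fin n) ℝ) (b c : Fin n → ℝ)
    (G : Matrix (Fin N) (Fin N) ℝ) (s : ℂ) (hA : IsUnit (characteristicPencil A s))
    (hh : nodalTransfer A b c s ≠ 0) (X : Matrix (Fin N × Fin n) (Fin N) ℂ)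
    (hX : (s • (1 : Matrix (Fin N × Fin n) (Fin N × Fin n) ℂ) -
      toComplex (networkStateMatrix A b c G)) * X = toComplex (networkInputMatrix N b)) :
    ((1 / nodalTransfer A b c s) • (1 : Matrix (Fin N) (Fin N) ℂ) - toComplex G) *
      (toComplex (networkOutputMatrix N c) * X) = 1 := by
  set H := toComplex (networkOutputMatrix N c) * X with hH
  set h := nodalTransfer A b c s with hh_def
  have hHX : ∀ k l, H k l = (fun q => (c q : ℂ)) ⬝ᵥ fun q => X (k, q) l := by
    intro k l
    rw [hH, mul_apply, Fintype.sum_prod_type, Finset.sum_eq_single k]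
    · simp [networkOutputMatrix_apply, dotProduct]
    · intro m _ hm
      simp [networkOutputMatrix_apply, Matrix.one_apply_ne hm.symm]
    · simp
  -- The rows of `(s - M) X = B` that belong to node `k`: a node sees the input `δ + G H`.
  have hcol : ∀ k l, characteristicPencil A s *ᵥ (fun p => X (k, p) l) =
      ((1 : Matrix (Fin N) (Fin N) ℂ) k l + (toComplex G * H) k l) • fun p => (b p : ℂ) := by
    intro k l
    ext p
    have hkp := congrFun (congrFun hX (k, p)) l
    rw [Matrix.sub_mul, Matrix.sub_apply, Matrix.smul_mul, Matrix.one_mul, Matrix.smul_apply,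
      mul_apply, Fintype.sum_prod_type] at hkp
    have h1 : ∑ m, ∑ q, toComplex (networkStateMatrix A b c G) (k, p) (m, q) * X (m, q) l =
        ∑ q, (A p q : ℂ) * X (k, q) l + (toComplex G * H) k l * b p := by
      simp only [map_apply, networkStateMatrix_apply, Complex.ofReal_add, Complex.ofReal_mul,
        add_mul, Finset.sum_add_distrib]
      congr 1
      · rw [Finset.sum_eq_single k]
        · simp
        · intro m _ hm
          simp [Matrix.one_apply_ne hm.symm]
        · simp
      · rw [mul_apply, Finset.sum_mul]
        refine Finset.sum_congr rfl fun m _ => ?_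
        rw [hHX, dotProduct, Finset.mul_sum, Finset.sum_mul]
        refine Finset.sum_congr rfl fun q _ => ?_
        simp only [map_apply]
        ring
    have h2 : toComplex (networkInputMatrix N b) (k, p) l =
        (1 : Matrix (Fin N) (Fin N) ℂ) k l * b p := by
      simp only [map_apply, networkInputMatrix_apply, Matrix.one_apply]
      split_ifs <;> simp
    rw [h1, h2, smul_eq_mul] at hkp
    rw [characteristicPencil, sub_mulVec, smul_mulVec, one_mulVec, Pi.sub_apply, Pi.smul_apply,
      Pi.smul_apply, smul_eq_mul, smul_eq_mul]
    change _ - ∑ q, (A p q : ℂ) * X (k, q) l = _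
    linear_combination hkp
  have hdet : IsUnit (characteristicPencil A s).det := (isUnit_iff_isUnit_det _).1 hA
  have hfeedback : H = h • (1 + toComplex G * H) := by
    ext k l
    have h1 : (fun p => X (k, p) l) = (characteristicPencil A s)⁻¹ *ᵥ
        (((1 : Matrix (Fin N) (Fin N) ℂ) k l + (toComplex G * H) k l) • fun p => (b p : ℂ)) := by
      rw [← hcol, mulVec_mulVec, nonsing_inv_mul _ hdet, one_mulVec]
    rw [hHX, h1, mulVec_smul, dotProduct_smul, Matrix.smul_apply, Matrix.add_apply, smul_eq_mul,
      smul_eq_mul, mul_comm]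
    rfl
  have h3 : (1 / h) • H = 1 + toComplex G * H := by
    nth_rewrite 1 [hfeedback]
    rw [smul_smul, one_div, inv_mul_cancel₀ hh, one_smul]
  rw [sub_mul, smul_mul_assoc, one_mul, h3, add_sub_cancel_right]

lemma inverseSpectrumMatrix_eq (G : Matrix (Fin N) (Fin N) ℝ) (h : ℂ) :
    inverseSpectrumMatrix G h =
      ((1 / h) • (1 : Matrix (Fin N) (Fin N) ℂ) - toComplex G)ᴴ *
        ((1 / h) • (1 : Matrix (Fin N) (Fin N) ℂ) - toComplex G) := by
  have hG : (toComplex G)ᴴ = (toComplex G)ᵀ := by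
    ext i j
    simp [conjTranspose_apply]
  have hnorm : (1 / (‖h‖ : ℂ) ^ 2) = (1 / conj h) * (1 / h) := by
    rw [← Complex.conj_mul', one_div_mul_one_div]
  have hstar : star (1 / h) = 1 / conj h := by simp
  rw [conjTranspose_sub, conjTranspose_smul, conjTranspose_one, hG, hstar, sub_mul, mul_sub,
    mul_sub, inverseSpectrumMatrix, hnorm]
  simp only [smul_mul_assoc, mul_smul_comm, one_mul, mul_one, smul_smul]
  rw [mul_comm (1 / h)]
  abel

/-- A right inverse `H` of `1 / h - G` yields `H Hᴴ` as inverse of the matrix of the spectral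
formula. -/
lemma isUnit_inverseSpectrumMatrix_and_inv_eq (G : Matrix (Fin N) (Fin N) ℝ) {h : ℂ}
    {H : Matrix (Fin N) (Fin N) ℂ}
    (hH : ((1 / h) • (1 : Matrix (Fin N) (Fin N) ℂ) - toComplex G) * H = 1) :
    IsUnit (inverseSpectrumMatrix G h) ∧ (inverseSpectrumMatrix G h)⁻¹ = H * Hᴴ := by
  have h1 : inverseSpectrumMatrix G h * (H * Hᴴ) = 1 := by
    rw [inverseSpectrumMatrix_eq, Matrix.mul_assoc, ← Matrix.mul_assoc _ H, hH,
      Matrix.one_mul, ← conjTranspose_mul, mul_eq_one_comm.1 hH, conjTranspose_one]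
  exact ⟨(isUnit_iff_isUnit_det _).2 (isUnit_det_of_right_inverse h1), inv_eq_right_inv h1⟩

end TransferMatrix

/-! ### The steady-state response as a filtered input -/

section SteadyState

variable {ι κ ν : Type*} [Fintype ι]

lemma mul_mul_apply_eq_sum {R : Type*} [CommSemiring R] (C : Matrix ν ι R) (E : Matrix ι ι R)
    (B : Matrix ι κ R) (i : ν) (k : κ) :
    (C * E * B) i k = ∑ q, ∑ p, C i p * E p q * B q k := by
  simp only [mul_apply, Finset.sum_mul]

/-- Vanishing deterministic weights times random vectors with bounded second moments tend to zero
almost surely along a subsequence. -/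
lemma exists_subseq_ae_tendsto_zero {S : Type*} [MeasurableSpace S] {μ : Measure S}
    [IsProbabilityMeasure μ] {a : ℕ → ι → ℝ} {X : ℕ → S → ι → ℝ} {K : ℝ}
    (ha : ∀ p, Tendsto (fun m => a m p) atTop (𝓝 0)) (hX : ∀ m p, MemLp (fun o => X m o p) 2 μ)
    (hK : ∀ m p, ∫ o, X m o p ^ 2 ∂μ ≤ K) :
    ∃ φ : ℕ → ℕ, StrictMono φ ∧
      ∀ᵐ o ∂μ, Tendsto (fun m => ∑ p, a (φ m) p * X (φ m) o p) atTop (𝓝 0) := by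
  set Z : ℕ → S → ℝ := fun m o => ∑ p, a m p * X m o p with hZ
  have hXi : ∀ m p, Integrable (fun o => X m o p) μ := fun m p => (hX m p).integrable one_le_two
  have hZi : ∀ m, Integrable (Z m) μ := fun m =>
    integrable_finsetSum _ fun p _ => (hXi m p).const_mul _
  have hX1 : ∀ m p, ∫ o, ‖X m o p‖ ∂μ ≤ K + 1 := by
    intro m p
    have h2 : ∫ o, (X m o p ^ 2 + 1) ∂μ ≤ K + 1 := by
      rw [integral_add (hX m p).integrable_sq (integrable_const _)]
      simpa using hK m p
    refine le_trans ?_ h2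
    refine integral_mono (hXi m p).norm ((hX m p).integrable_sq.add (integrable_const _))
      fun o => ?_
    simp only [Real.norm_eq_abs]
    nlinarith [sq_nonneg (|X m o p| - 1), sq_abs (X m o p)]
  have hZ1 : ∀ m, ∫ o, ‖Z m o‖ ∂μ ≤ ∑ p, |a m p| * (K + 1) := by
    intro m
    calc ∫ o, ‖Z m o‖ ∂μ ≤ ∫ o, ∑ p, |a m p| * ‖X m o p‖ ∂μ := by
          refine integral_mono (hZi m).norm
            (integrable_finsetSum _ fun p _ => (hXi m p).norm.const_mul _) fun o => ?_
          refine (norm_sum_le _ _).trans (Finset.sum_le_sum fun p _ => ?_)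
          rw [norm_mul, Real.norm_eq_abs (a m p)]
      _ = ∑ p, |a m p| * ∫ o, ‖X m o p‖ ∂μ := by
          rw [integral_finsetSum _ fun p _ => (hXi m p).norm.const_mul _]
          simp_rw [integral_const_mul]
      _ ≤ _ := Finset.sum_le_sum fun p _ => mul_le_mul_of_nonneg_left (hX1 m p) (abs_nonneg _)
  have hlim : Tendsto (fun m => ∫ o, ‖Z m o‖ ∂μ) atTop (𝓝 0) := by
    refine squeeze_zero (fun m => by positivity) hZ1 ?_
    simpa using tendsto_finsetSum Finset.univ fun p _ => (ha p).abs.mul_const (K + 1)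
  have hmeasure : TendstoInMeasure μ Z atTop fun _ => (0 : ℝ) := by
    refine tendstoInMeasure_of_tendsto_eLpNorm one_ne_zero
      (fun m => (hZi m).aestronglyMeasurable) aestronglyMeasurable_const ?_
    have h := ENNReal.tendsto_ofReal hlim
    rw [ENNReal.ofReal_zero] at h
    refine h.congr fun m => ?_
    rw [ofReal_integral_norm_eq_lintegral_enorm (hZi m), eLpNorm_one_eq_lintegral_enorm]
    simp
  exact hmeasure.exists_seq_tendsto_ae

variable [DecidableEq ι]

/-- The impulse response `C exp (sM) B`, `s > 0`, of `x' = M x + B u`, `y = C x`, from the `k`-th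
input to the `i`-th output, extended by zero to `s ≤ 0`. -/
noncomputable def impulseResponse (M : Matrix ι ι ℝ) (B : Matrix ι κ ℝ) (C : Matrix ν ι ℝ)
    (i : ν) (k : κ) : ℝ → ℝ :=
  indicator (Ioi 0) fun s => (C * NormedSpace.exp (s • M) * B) i k

lemma toComplex_exp_smul (M : Matrix ι ι ℝ) (t : ℝ) :
    toComplex (NormedSpace.exp (t • M)) = NormedSpace.exp ((t : ℂ) • toComplex M) := by
  open scoped Matrix.Norms.Operator in
  have h := NormedSpace.map_exp (Complex.ofRealHom.mapMatrix (m := ι))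
    (continuous_id.matrix_map Complex.continuous_ofReal) (t • M)
  refine h.trans ?_
  congr 1
  ext i j
  simp

lemma ofReal_exp_smul_apply (M : Matrix ι ι ℝ) (t : ℝ) (p q : ι) :
    ((NormedSpace.exp (t • M) p q : ℝ) : ℂ) = NormedSpace.exp ((t : ℂ) • toComplex M) p q := by
  rw [← toComplex_exp_smul]
  rfl

lemma re_exp_smul_apply (M : Matrix ι ι ℝ) (t : ℝ) (p q : ι) :
    (NormedSpace.exp ((t : ℂ) • toComplex M) p q).re = NormedSpace.exp (t • M) p q := by
  rw [← ofReal_exp_smul_apply, Complex.ofReal_re]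

lemma IsHurwitz.integrableOn_exp_smul_apply {M : Matrix ι ι ℝ} (hM : IsHurwitz M) (p q : ι) :
    IntegrableOn (fun t : ℝ => NormedSpace.exp (t • M) p q) (Ioi 0) := by
  have h := (isDecaying_exp_smul_apply _ hM p q).integrableOn.re
  exact h.congr (Eventually.of_forall fun t => re_exp_smul_apply M t p q)

lemma IsHurwitz.tendsto_exp_smul_apply {M : Matrix ι ι ℝ} (hM : IsHurwitz M) (p q : ι) :
    Tendsto (fun t : ℝ => NormedSpace.exp (t • M) p q) atTop (𝓝 0) := by
  have h := (Complex.continuous_re.tendsto _).comp (isDecaying_exp_smul_apply _ hM p q).tendsto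
  exact h.congr fun t => re_exp_smul_apply M t p q

lemma IsHurwitz.integrable_impulseResponse {M : Matrix ι ι ℝ} (hM : IsHurwitz M)
    (B : Matrix ι κ ℝ) (C : Matrix ν ι ℝ) (i : ν) (k : κ) :
    Integrable (impulseResponse M B C i k) := by
  refine (integrable_indicator_iff measurableSet_Ioi).2 ?_
  simp_rw [mul_mul_apply_eq_sum]
  exact integrable_finsetSum _ fun q _ => integrable_finsetSum _ fun p _ =>
    ((hM.integrableOn_exp_smul_apply p q).const_mul _).mul_const _

lemma IsHurwitz.spectralDensity_impulseResponse {M : Matrix ι ι ℝ} (hM : IsHurwitz M)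
    (B : Matrix ι κ ℝ) (C : Matrix ν ι ℝ) (i : ν) (k : κ) (ω : ℝ) :
    spectralDensity (impulseResponse M B C i k) ω = (toComplex C * (Matrix.of fun p q =>
      ∫ t in Ioi (0 : ℝ), NormedSpace.exp ((t : ℂ) • toComplex M) p q *
        Complex.exp (-(Complex.I * ω * t))) * toComplex B) i k := by
  have hint : ∀ p q, IntegrableOn (fun t : ℝ => NormedSpace.exp ((t : ℂ) • toComplex M) p q *
      Complex.exp (-(Complex.I * ω * t))) (Ioi 0) := fun p q =>
    (isDecaying_exp_smul_apply _ hM p q).integrableOn.mul_bdd (c := 1)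
      (continuous_cexp_neg_I_mul ω).aestronglyMeasurable
      (Eventually.of_forall fun t => (norm_cexp_neg_I_mul ω t).le)
  have h1 : spectralDensity (impulseResponse M B C i k) ω = ∫ t in Ioi (0 : ℝ),
      (((C * NormedSpace.exp (t • M) * B) i k : ℝ) : ℂ) * Complex.exp (-(Complex.I * ω * t)) := by
    rw [spectralDensity, ← integral_indicator measurableSet_Ioi]
    refine integral_congr_ae (Eventually.of_forall fun t => ?_)
    by_cases ht : t ∈ Ioi (0 : ℝ) <;> simp [impulseResponse, ht]
  rw [h1, mul_mul_apply_eq_sum]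
  simp only [of_apply, map_apply]
  have h2 : ∀ p q, (C i p : ℂ) * (∫ t in Ioi (0 : ℝ), NormedSpace.exp ((t : ℂ) • toComplex M) p q *
        Complex.exp (-(Complex.I * ω * t))) * (B q k : ℂ) = ∫ t in Ioi (0 : ℝ), (C i p : ℂ) *
        (NormedSpace.exp ((t : ℂ) • toComplex M) p q * Complex.exp (-(Complex.I * ω * t))) *
          (B q k : ℂ) := fun p q => by
    rw [integral_mul_const, integral_const_mul]
  simp_rw [h2]
  rw [Finset.sum_congr rfl fun q _ => (integral_finsetSum _ fun p _ =>
      ((hint p q).const_mul (C i p : ℂ)).mul_const (B q k : ℂ)).symm,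
    ← integral_finsetSum _ fun q _ => integrable_finsetSum _ fun p _ =>
      ((hint p q).const_mul (C i p : ℂ)).mul_const (B q k : ℂ)]
  refine integral_congr_ae (Eventually.of_forall fun t => ?_)
  simp only [mul_mul_apply_eq_sum, Complex.ofReal_sum, Complex.ofReal_mul, ofReal_exp_smul_apply,
    Finset.sum_mul]
  refine Finset.sum_congr rfl fun q _ => Finset.sum_congr rfl fun p _ => ?_
  ring

variable [Fintype κ]

/-- The output at time `t` is the free motion from time `t - T` plus the input of the last `T` time
units, weighted by the impulse response. -/
lemma IsSolutionPath.output_eq {M : Matrix ι ι ℝ} {B : Matrix ι κ ℝ} {u : ℝ → κ → ℝ}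
    {ξ : ℝ → ι → ℝ} (h : IsSolutionPath M B u ξ) (C : Matrix ν ι ℝ) (i : ν) (t T : ℝ) :
    (C *ᵥ ξ t) i = ∑ p, (C * NormedSpace.exp (T • M)) i p * ξ (t - T) p +
      ∑ k, ∫ s in (0 : ℝ)..T, (C * NormedSpace.exp (s • M) * B) i k * u (t - s) k := by
  have hcont : ∀ p k, Continuous fun r : ℝ => (NormedSpace.exp ((t - r) • M) * B) p k :=
    fun p k => (((continuous_exp_smul M).comp (continuous_const.sub continuous_id)).matrix_mul
      continuous_const).matrix_elem p k
  have hint : ∀ p k, IntervalIntegrable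
      (fun r => (NormedSpace.exp ((t - r) • M) * B) p k * u r k) volume (t - T) t := fun p k =>
    (h.intervalIntegrable_input k _ _).continuousOn_mul (hcont p k).continuousOn
  have hforced : ∀ p, ∫ r in (t - T)..t, (NormedSpace.exp ((t - r) • M) *ᵥ (B *ᵥ u r)) p =
      ∑ k, ∫ r in (t - T)..t, (NormedSpace.exp ((t - r) • M) * B) p k * u r k := by
    intro p
    rw [← intervalIntegral.integral_finsetSum fun k _ => hint p k]
    simp only [mulVec_mulVec]
    rfl
  have hsub : ∀ k, ∫ s in (0 : ℝ)..T, (C * NormedSpace.exp (s • M) * B) i k * u (t - s) k =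
      ∫ r in (t - T)..t, (C * NormedSpace.exp ((t - r) • M) * B) i k * u r k := by
    intro k
    have h1 := intervalIntegral.integral_comp_sub_left (a := t - T) (b := t)
      (fun s => (C * NormedSpace.exp (s • M) * B) i k * u (t - s) k) t
    simp only [sub_sub_cancel, sub_self] at h1
    exact h1.symm
  rw [h.variation_of_constants (t - T) t, mulVec_add, Pi.add_apply, mulVec_mulVec, sub_sub_cancel]
  congr 1
  simp only [mulVec, dotProduct] at hforced ⊢
  simp_rw [hforced, hsub, Finset.mul_sum]
  rw [Finset.sum_comm]
  refine Finset.sum_congr rfl fun k _ => ?_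
  simp_rw [← intervalIntegral.integral_const_mul]
  rw [← intervalIntegral.integral_finsetSum fun p _ => (hint p k).const_mul _]
  refine intervalIntegral.integral_congr fun r _ => ?_
  simp only [Matrix.mul_assoc C, mul_apply (M := C), Finset.sum_mul, mul_assoc]

/-- A steady-state response of a Hurwitz system has forgotten its initial condition, so it is the
response of the filter given by the impulse response. -/
lemma IsSteadyStateResponse.isFilterResponse {S : Type*} [MeasurableSpace S] {μ : Measure S}
    [IsProbabilityMeasure μ] {M : Matrix ι ι ℝ} {B : Matrix ι κ ℝ}
    {w : ℝ → S → κ → ℝ} {x : ℝ → S → ι → ℝ} {R : ℝ → ℝ}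
    (hx : IsSteadyStateResponse μ M B w x) (hM : IsHurwitz M)
    (hw : IsUncorrelatedWSSInput μ w R) (C : Matrix ν ι ℝ) :
    IsFilterResponse μ (impulseResponse M B C) w (outputProcess C x) where
  integrable := hM.integrable_impulseResponse B C
  memLp i t := by
    have h : component (outputProcess C x) i t = fun o => ∑ p, C i p * component x p t o := rfl
    rw [h]
    exact memLp_finsetSum _ fun p _ => (hx.memLp p t).const_mul _
  eq_conv i t := by
    obtain ⟨K, hK⟩ := hx.bounded
    have ha : ∀ p, Tendsto (fun m : ℕ => (C * NormedSpace.exp ((m : ℝ) • M)) i p) atTop (𝓝 0) := by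
      intro p
      simp only [mul_apply]
      simpa using tendsto_finsetSum Finset.univ fun q _ =>
        ((hM.tendsto_exp_smul_apply q p).comp tendsto_natCast_atTop_atTop).const_mul (C i q)
    obtain ⟨φ, hφ, hzero⟩ := exists_subseq_ae_tendsto_zero (μ := μ)
      (X := fun m o => x (t - m) o) ha (fun m p => hx.memLp p (t - m)) (fun m p => hK p (t - m))
    have hint : ∀ᵐ o ∂μ, ∀ k, Integrable fun s => impulseResponse M B C i k s * w (t - s) o k :=
      ae_all_iff.2 fun k =>
        (hw.integrable_filter (hM.integrable_impulseResponse B C i k) k t).prod_left_ae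
    filter_upwards [hx.solution, hzero, hint] with o hsol hz hi
    have hind : ∀ k, (fun s => impulseResponse M B C i k s * w (t - s) o k) =
        indicator (Ioi 0) fun s => (C * NormedSpace.exp (s • M) * B) i k * w (t - s) o k := by
      intro k
      ext s
      by_cases hs : s ∈ Ioi (0 : ℝ) <;> simp [impulseResponse, hs]
    have hconv : Tendsto (fun m => ∑ k, ∫ s in (0 : ℝ)..(φ m : ℝ),
        (C * NormedSpace.exp (s • M) * B) i k * w (t - s) o k) atTop
        (𝓝 (∑ k, ∫ s, impulseResponse M B C i k s * w (t - s) o k)) := by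
      refine tendsto_finsetSum _ fun k _ => ?_
      rw [hind k, integral_indicator measurableSet_Ioi]
      refine intervalIntegral_tendsto_integral_Ioi 0 ?_
        (tendsto_natCast_atTop_atTop.comp hφ.tendsto_atTop)
      rw [← integrable_indicator_iff measurableSet_Ioi, ← hind k]
      exact hi k
    have hsum := hz.add hconv
    rw [zero_add] at hsum
    refine tendsto_nhds_unique ?_ hsum
    refine tendsto_const_nhds.congr fun m => ?_
    exact hsol.output_eq C i t (φ m)

end SteadyState

end

/-! ### The output spectrum of the network -/

theorem lemma2 {S : Type*} [MeasurableSpace S] (μ : Measure S) [IsProbabilityMeasure μ]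
    {N n : ℕ} (A : Matrix (Fin n) (Fin n) ℝ) (b c : Fin n → ℝ) (G : Matrix (Fin N) (Fin N) ℝ)
    (hstable : IsHurwitz (networkStateMatrix A b c G))
    (w : ℝ → S → Fin N → ℝ) (Rw : ℝ → ℝ)
    (hA1 : IsUncorrelatedWSSInput μ w Rw) (hRw : Integrable Rw volume)
    (hA2 : ∃ β : ℝ, IsExcitationInterval μ w β)
    (x : ℝ → S → Fin N × Fin n → ℝ)
    (hx : IsSteadyStateResponse μ (networkStateMatrix A b c G) (networkInputMatrix N b) w x)
    (y : ℝ → S → Fin N → ℝ) (hy : y = outputProcess (networkOutputMatrix N c) x) :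
    IsJointlyWSS μ y ∧
    (∀ i j, Integrable (crossCorrelation μ (component y i) (component y j)) volume) ∧
    ∀ ω : ℝ, IsUnit (characteristicPencil A (Complex.I * ω)) →
      nodalTransfer A b c (Complex.I * ω) ≠ 0 →
      IsUnit (inverseSpectrumMatrix G (nodalTransfer A b c (Complex.I * ω))) ∧
      cpsdMatrix μ y ω = spectralDensity Rw ω •
        (inverseSpectrumMatrix G (nodalTransfer A b c (Complex.I * ω)))⁻¹ := by
  subst hy
  have hfilter := hx.isFilterResponse hstable hA1 (networkOutputMatrix N c)
  refine ⟨hfilter.isJointlyWSS hA1, hfilter.integrable_crossCorrelation hA1 hRw,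
    fun ω hA hh => ?_⟩
  -- The resolvent of the network matrix, obtained as a Laplace transform.
  set L : Matrix (Fin N × Fin n) (Fin N × Fin n) ℂ := Matrix.of fun p q =>
    ∫ t in Set.Ioi (0 : ℝ), NormedSpace.exp ((t : ℂ) • toComplex (networkStateMatrix A b c G)) p q *
      Complex.exp (-(Complex.I * ω * t)) with hL
  have hres : ((Complex.I * ω) • (1 : Matrix (Fin N × Fin n) (Fin N × Fin n) ℂ) -
      toComplex (networkStateMatrix A b c G)) * (L * toComplex (networkInputMatrix N b)) =
      toComplex (networkInputMatrix N b) := by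
    rw [← Matrix.mul_assoc, hL, sub_mul_laplace_exp _ hstable ω, Matrix.one_mul]
  obtain ⟨hunit, hinv⟩ := isUnit_inverseSpectrumMatrix_and_inv_eq G
    (loop_inverse A b c G _ hA hh _ hres)
  refine ⟨hunit, ?_⟩
  have hfreq : (Matrix.of fun i k => spectralDensity (impulseResponse (networkStateMatrix A b c G)
      (networkInputMatrix N b) (networkOutputMatrix N c) i k) ω) =
      toComplex (networkOutputMatrix N c) * (L * toComplex (networkInputMatrix N b)) := by
    ext i k
    rw [of_apply, hstable.spectralDensity_impulseResponse, ← Matrix.mul_assoc]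
  rw [hfilter.cpsdMatrix_eq hA1 hRw, hinv, hfreq]
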